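/- Let $G$ be a group. For a matrix $A \in M_{r,s}(\mathbb{Z}G)$ with $r,s \ge 1$ let $r_A^{(2)} \colon L^2(G)^r \to L^2(G)^s$, $(x_k)_k \mapsto \bigl(\sum_{k} x_k a_{k,j}\bigr)_j$, be the bounded $G$-equivariant operator given by right multiplication with $A$. For a bounded $G$-equivariant operator $f \colon L^2(G)^r \to L^2(G)^s$ let $F_f(\lambda) = \dim_{\mathcal{N}(G)}\bigl(\operatorname{im} E^{f^*f}_{\lambda^2}\bigr)$ for $\lambda \ge 0$ (and $F_f(\lambda) = 0$ for $\lambda<0$) be its spectral density function, where $\{E^{f^*f}_{\mu}\}_{\mu\in\mathbb{R}}$ is the right-continuous family of spectral projections of $f^*f$ and $\dim_{\mathcal{N}(G)}(\operatorname{im} E) = \sum_{i=1}^r \langle E(e_i), e_i\rangle$ with $e_i \in L^2(G)^r$ the vector whose $i$-th entry is the unit element of $G$ and whose other entries are $0$. The Fuglede-Kadison determinant of $f$ is $\det_{\mathcal{N}(G)}(f) = \exp\bigl(\int_{0+}^\infty \ln(\lambda)\, dF_f\bigr)$ if the integral converges to a real number, and $0$ otherwise. Define $\Lambda(G)$ to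 be the infimum of the numbers $\det_{\mathcal{N}(G)}(r_A^{(2)})$, where $A$ runs through all $(r,s)$-matrices over $\mathbb{Z}G$, for all $r,s\ge 1$, with $\det_{\mathcal{N}(G)}(r_A^{(2)}) > 1$. Define $\Lambda_1(G)$ in the same way using only $(1,1)$-matrices, $\Lambda^w(G)$ using only square matrices $A$ for which $r_A^{(2)}$ is a weak isomorphism (injective with dense image), and $\Lambda_1^w(G)$ using only $(1,1)$-matrices $A$ for which $r_A^{(2)}$ is a weak isomorphism. Let $L = \mathbb{Z}/2 \wr \mathbb{Z} = \bigl(\bigoplus_{\mathbb{Z}} \mathbb{Z}/2\bigr) \rtimes \mathbb{Z}$ be the lamplighter group. Then $L$ is finitely generated, it contains finite subgroups of arbitrarily large order, and \[ \Lambda(L) = \Lambda^w(L) = \Lambda_1(L) = \Lambda_1^w(L) = 1. \] Moreover, $L$ is isomorphic to a subgroup of a finitely presented group $G$ with \[ \Lambda(G) = \Lambda^w(G) = \Lambda_1(G) = \Lambda_1^w(G) = 1. \] In particular, there exists a finitely presented group all four of whose constants are equal to $1$. -/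

import Mathlib

open MeasureTheory

noncomputable section

namespace Lehmer

/-! ### The lamplighter group -/

/-- The shift action of `ℤ` on the finitely supported functions `ℤ → ℤ/2`:
`n` sends `u` to `k ↦ u (k - n)`. -/
def lampShift :
    Multiplicative ℤ →* MulAut (Multiplicative (ℤ →₀ ZMod 2)) where
  toFun n := AddEquiv.toMultiplicative (Finsupp.domCongr (Equiv.addRight n.toAdd))
  map_one' := by
    ext u k
    change u.toAdd (k + -0) = u.toAdd k
    simp
  map_mul' m n := by
    ext u k
    change u.toAdd (k + -(m.toAdd + n.toAdd)) = u.toAdd (k + -m.toAdd + -n.toAdd)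
    congr 1
    ring

/-- The lamplighter group `ℤ/2 ≀ ℤ`, the restricted wreath product
`(⨁_ℤ ℤ/2) ⋊ ℤ` with respect to the shift. -/
abbrev Lamplighter : Type :=
  Multiplicative (ℤ →₀ ZMod 2) ⋊[lampShift] Multiplicative ℤ

/-! ### The Hilbert spaces `L²(G)^r` and right multiplication by matrices -/

section Operators

variable (G : Type*)

/-- The Hilbert space `L²(G)` of square summable functions `G → ℂ`. -/
abbrev L2 : Type _ := lp (fun _ : G => ℂ) 2

/-- The Hilbert space `L²(G)^r`, the orthogonal direct sum of `r` copies of `L²(G)`. -/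
abbrev L2Pow (r : ℕ) : Type _ := PiLp 2 (fun _ : Fin r => L2 G)

variable {G} [Group G]

/-- Right translation `x ↦ x · h` on `L²(G)`. It sends the basis element `g` to `g * h`,
that is, `(x · h)(g) = x (g * h⁻¹)`. -/
def rightTranslation (h : G) : L2 G →ₗᵢ[ℂ] L2 G where
  toFun x := ⟨fun g => x (g * h⁻¹), by
    refine (memℓp_gen_iff (by norm_num)).mpr ?_
    exact (Equiv.mulRight h⁻¹).summable_iff.mpr
      ((memℓp_gen_iff (by norm_num)).mp (lp.memℓp x))⟩
  map_add' x y := by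
    ext g
    rfl
  map_smul' c x := by
    ext g
    rfl
  norm_map' x := by
    rw [lp.norm_eq_tsum_rpow (by norm_num), lp.norm_eq_tsum_rpow (by norm_num)]
    congr 1
    exact (Equiv.mulRight h⁻¹).tsum_eq (fun g => ‖x g‖ ^ (2 : ENNReal).toReal)

/-- Right multiplication `x ↦ x · a` on `L²(G)` by an element `a` of the integral group ring. -/
def rightMul (a : MonoidAlgebra ℤ G) : L2 G →L[ℂ] L2 G :=
  ∑ h ∈ a.coeff.support, (a.coeff h : ℂ) • (rightTranslation h).toContinuousLinearMap

/-- The bounded operator `r_A^{(2)} : L²(G)^r → L²(G)^s` given by right multiplication with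
`A`, that is, `(x_k)_k ↦ (∑_k x_k · a_{k,j})_j`. -/
def rightMulMatrix {r s : ℕ} (A : Matrix (Fin r) (Fin s) (MonoidAlgebra ℤ G)) :
    L2Pow G r →L[ℂ] L2Pow G s :=
  (PiLp.continuousLinearEquiv 2 ℂ (fun _ : Fin s => L2 G)).symm.toContinuousLinearMap ∘L
    ContinuousLinearMap.pi fun j =>
      ∑ k, rightMul (A k j) ∘L PiLp.proj 2 (fun _ : Fin r => L2 G) k

end Operators

/-! ### Spectral projections -/

section Spectral

variable {H : Type*} [NormedAddCommGroup H] [InnerProductSpace ℂ H] [CompleteSpace H]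

/-- The image of the spectral projection `E_c` of a selfadjoint operator `T`, that is, the
spectral subspace of `T` belonging to `(-∞, c]`: the kernel of the positive part
`(T - c)⁺`. -/
def spectralSubspace (T : H →L[ℂ] H) (c : ℝ) : Submodule ℂ H :=
  (cfc (fun x : ℝ => max (x - c) 0) T).ker

instance (T : H →L[ℂ] H) (c : ℝ) : CompleteSpace (spectralSubspace T c) :=
  inferInstanceAs (CompleteSpace (cfc (fun x : ℝ => max (x - c) 0) T).ker)

/-- The spectral projection `E_c` of a selfadjoint operator `T`. -/
def spectralProjection (T : H →L[ℂ] H) (c : ℝ) : H →L[ℂ] H :=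
  (spectralSubspace T c).starProjection

theorem spectralSubspace_mono (T : H →L[ℂ] H) : Monotone (spectralSubspace T) := by
  intro c d hcd x hx
  rcases hcd.eq_or_lt with rfl | hlt
  · exact hx
  let q : ℝ → ℝ := fun t => max (t - d) 0 / max (t - c) (d - c)
  have hpos : ∀ t : ℝ, max (t - c) (d - c) ≠ 0 := fun t =>
    (lt_of_lt_of_le (sub_pos.mpr hlt) (le_max_right _ _)).ne'
  have hq : Continuous q := by
    refine Continuous.div (by fun_prop) (by fun_prop) hpos
  have key : (fun t : ℝ => max (t - d) 0) = fun t => q t * max (t - c) 0 := by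
    funext t
    simp only [q]
    rcases le_total t d with h | h
    · rw [max_eq_right (by linarith : t - d ≤ 0)]
      simp
    · rw [max_eq_left (by linarith : d - c ≤ t - c), max_eq_left (by linarith : 0 ≤ t - c)]
      have : t - c ≠ 0 := by linarith [sub_pos.mpr hlt] |> fun (h : 0 < t - c) => h.ne'
      field_simp
  change cfc (fun t : ℝ => max (t - c) 0) T x = 0 at hx
  change cfc (fun t : ℝ => max (t - d) 0) T x = 0
  rw [key, cfc_mul (fun t => q t) (fun t => max (t - c) 0) T hq.continuousOn
    (by fun_prop)]
  simp [hx]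

theorem iInf_spectralSubspace (T : H →L[ℂ] H) (c : ℝ) :
    ⨅ n : ℕ, spectralSubspace T (c + 1 / ((n : ℝ) + 1)) = spectralSubspace T c := by
  apply le_antisymm
  · intro x hx
    rw [Submodule.mem_iInf] at hx
    change cfc (fun t : ℝ => max (t - c) 0) T x = 0
    have bound : ∀ n : ℕ,
        ‖cfc (fun t : ℝ => max (t - c) 0) T x‖ ≤ 1 / ((n : ℝ) + 1) * ‖x‖ := by
      intro n
      have hn : (0 : ℝ) ≤ 1 / ((n : ℝ) + 1) := by positivity
      have h0 : cfc (fun t : ℝ => max (t - (c + 1 / ((n : ℝ) + 1))) 0) T x = 0 := hx n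
      have h1 : cfc (fun t : ℝ => max (t - c) 0) T x =
          cfc (fun t : ℝ => max (t - c) 0 - max (t - (c + 1 / ((n : ℝ) + 1))) 0) T x := by
        rw [cfc_sub (fun t : ℝ => max (t - c) 0)
          (fun t : ℝ => max (t - (c + 1 / ((n : ℝ) + 1))) 0) T (by fun_prop) (by fun_prop),
          sub_apply, h0, sub_zero]
      rw [h1]
      refine (ContinuousLinearMap.le_opNorm _ _).trans ?_
      gcongr
      refine norm_cfc_le hn fun t _ => ?_
      rw [Real.norm_eq_abs]
      refine (abs_max_sub_max_le_abs _ _ _).trans ?_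
      rw [show t - c - (t - (c + 1 / ((n : ℝ) + 1))) = 1 / ((n : ℝ) + 1) by ring,
        abs_of_nonneg hn]
    have lim : Filter.Tendsto (fun n : ℕ => 1 / ((n : ℝ) + 1) * ‖x‖) Filter.atTop
        (nhds (0 * ‖x‖)) := tendsto_one_div_add_atTop_nhds_zero_nat.mul_const _
    have := ge_of_tendsto' lim bound
    rw [zero_mul] at this
    exact norm_le_zero_iff.mp this
  · refine le_iInf fun n => spectralSubspace_mono T ?_
    have : (0 : ℝ) ≤ 1 / ((n : ℝ) + 1) := by positivity
    linarith

theorem tendsto_spectralProjection (T : H →L[ℂ] H) (c : ℝ) (x : H) :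
    Filter.Tendsto (fun n : ℕ => spectralProjection T (c + 1 / ((n : ℝ) + 1)) x) Filter.atTop
      (nhds (spectralProjection T c x)) := by
  let K : ℕ → Submodule ℂ H := fun n => spectralSubspace T (c + 1 / ((n : ℝ) + 1))
  have hK : ∀ n, (K n)ᗮᗮ = K n := fun n => by
    have : CompleteSpace (K n) :=
      inferInstanceAs (CompleteSpace (spectralSubspace T (c + 1 / ((n : ℝ) + 1))))
    exact Submodule.orthogonal_orthogonal (K n)
  have hmono : Monotone fun n => (K n)ᗮ := by
    intro m n hmn
    refine Submodule.orthogonal_le (spectralSubspace_mono T ?_)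
    have : 1 / ((n : ℝ) + 1) ≤ 1 / ((m : ℝ) + 1) := by gcongr
    linarith
  have hcl : (⨆ n, (K n)ᗮ).topologicalClosure = (spectralSubspace T c)ᗮ := by
    rw [← Submodule.orthogonal_orthogonal_eq_closure, ← Submodule.iInf_orthogonal]
    simp only [hK]
    rw [iInf_spectralSubspace T c]
  have h := Submodule.starProjection_tendsto_closure_iSup (fun n => (K n)ᗮ) hmono x
  simp only [hcl] at h
  have h2 := h.const_sub x
  simpa [K, Submodule.starProjection_orthogonal, spectralProjection] using h2

theorem inner_spectralProjection_nonneg (T : H →L[ℂ] H) (c : ℝ) (x : H) :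
    0 ≤ (inner ℂ x (spectralProjection T c x)).re :=
  (ContinuousLinearMap.IsPositive.of_isStarProjection
    (isStarProjection_starProjection (U := spectralSubspace T c))).re_inner_nonneg_right x

theorem inner_spectralProjection_mono (T : H →L[ℂ] H) (x : H) :
    Monotone fun c => (inner ℂ x (spectralProjection T c x)).re := by
  intro c d hcd
  have h : spectralProjection T c ≤ spectralProjection T d :=
    Submodule.starProjection_le_starProjection_iff.mpr (spectralSubspace_mono T hcd)
  have := ((ContinuousLinearMap.le_def _ _).mp h).re_inner_nonneg_right x
  simpa [inner_sub_right] using this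

end Spectral

/-! ### Von Neumann trace and dimension -/

section FugledeKadison

variable {G : Type*} [Group G]

open Classical in
/-- The unit element `e ∈ G ⊆ L²(G)`. -/
def unitVector (G : Type*) [Group G] : L2 G := lp.single 2 (1 : G) (1 : ℂ)

/-- The element of `L²(G)^r` with the unit element of `G` as its `i`-th entry and zeros
elsewhere. -/
def basisVector (G : Type*) [Group G] {r : ℕ} (i : Fin r) : L2Pow G r :=
  PiLp.single 2 i (unitVector G)

/-- The von Neumann trace of a bounded `G`-equivariant operator `f` on `L²(G)^r`: the sum of the
traces `⟨f_{i,i}(e), e⟩` of its diagonal entries. -/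
def vonNeumannTrace {r : ℕ} (f : L2Pow G r →L[ℂ] L2Pow G r) : ℂ :=
  ∑ i, inner ℂ (basisVector G i) (f (basisVector G i))

/-- The von Neumann dimension of a closed `G`-invariant subspace `V` of `L²(G)^r`: the trace of
the orthogonal projection onto `V` (this trace is real). -/
def vonNeumannDim {r : ℕ} (V : Submodule ℂ (L2Pow G r)) [V.HasOrthogonalProjection] : ℝ :=
  (vonNeumannTrace V.starProjection).re

/-! ### The Fuglede-Kadison determinant -/

/-- The spectral density function `F_f(t) = dim (im E_{t²}^{f^* f})` for `t ≥ 0`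
(and `0` for `t < 0`). -/
def spectralDensity {r s : ℕ} (f : L2Pow G r →L[ℂ] L2Pow G s) (t : ℝ) : ℝ :=
  if 0 ≤ t then vonNeumannDim (spectralSubspace (f.adjoint ∘L f) (t ^ 2)) else 0

theorem vonNeumannDim_spectralSubspace {r : ℕ} (T : L2Pow G r →L[ℂ] L2Pow G r) (c : ℝ) :
    vonNeumannDim (spectralSubspace T c) =
      ∑ i, (inner ℂ (basisVector G i) (spectralProjection T c (basisVector G i))).re := by
  simp [vonNeumannDim, vonNeumannTrace, spectralProjection]

theorem spectralDensity_mono {r s : ℕ} (f : L2Pow G r →L[ℂ] L2Pow G s) :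
    Monotone (spectralDensity f) := by
  intro t u htu
  unfold spectralDensity
  split_ifs with h1 h2 h2
  · simp only [vonNeumannDim_spectralSubspace]
    exact Finset.sum_le_sum fun i _ => inner_spectralProjection_mono _ _ (by gcongr)
  · exact absurd (h1.trans htu) h2
  · rw [vonNeumannDim_spectralSubspace]
    exact Finset.sum_nonneg fun i _ => inner_spectralProjection_nonneg _ _ _
  · exact le_rfl

theorem spectralDensity_rightCont {r s : ℕ} (f : L2Pow G r →L[ℂ] L2Pow G s) (t : ℝ) :
    ContinuousWithinAt (spectralDensity f) (Set.Ici t) t := by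
  rw [← continuousWithinAt_Ioi_iff_Ici]
  have hlim := (spectralDensity_mono f).tendsto_nhdsGT t
  suffices h : sInf (spectralDensity f '' Set.Ioi t) = spectralDensity f t by
    rw [h] at hlim
    exact hlim
  rcases lt_or_ge t 0 with ht | ht
  · refine tendsto_nhds_unique hlim (tendsto_const_nhds.congr' ?_)
    filter_upwards [Ioo_mem_nhdsGT ht] with u hu
    simp [spectralDensity, not_le.mpr ht, not_le.mpr hu.2]
  · let T := f.adjoint ∘L f
    let u : ℕ → ℝ := fun n => Real.sqrt (t ^ 2 + 1 / ((n : ℝ) + 1))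
    have hpos : ∀ n : ℕ, (0 : ℝ) < 1 / ((n : ℝ) + 1) := fun n => by positivity
    have hu : Filter.Tendsto u Filter.atTop (nhdsWithin t (Set.Ioi t)) := by
      refine tendsto_nhdsWithin_iff.mpr ⟨?_, Filter.Eventually.of_forall fun n => ?_⟩
      · have h := (tendsto_one_div_add_atTop_nhds_zero_nat (𝕜 := ℝ)).const_add (t ^ 2)
        have h' := (Real.continuous_sqrt.tendsto _).comp h
        simpa [Real.sqrt_sq ht, Function.comp_def, u] using h'
      · exact Real.lt_sqrt_of_sq_lt (by linarith [hpos n])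
    refine tendsto_nhds_unique (hlim.comp hu) ?_
    have hval : ∀ n, spectralDensity f (u n) = ∑ i, (inner ℂ (basisVector G i)
        (spectralProjection T (t ^ 2 + 1 / ((n : ℝ) + 1)) (basisVector G i))).re := fun n => by
      have hsq : u n ^ 2 = t ^ 2 + 1 / ((n : ℝ) + 1) :=
        Real.sq_sqrt (by have := hpos n; positivity)
      rw [← hsq, ← vonNeumannDim_spectralSubspace]
      exact if_pos (Real.sqrt_nonneg _)
    have hval0 : spectralDensity f t = ∑ i, (inner ℂ (basisVector G i)
        (spectralProjection T (t ^ 2) (basisVector G i))).re := by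
      rw [← vonNeumannDim_spectralSubspace]
      simp [spectralDensity, ht, T]
    rw [hval0]
    simp only [Function.comp_def, hval]
    refine tendsto_finsetSum _ fun i _ => ?_
    exact (Complex.continuous_re.tendsto _).comp
      (tendsto_const_nhds.inner (tendsto_spectralProjection T _ _))

/-- The spectral density function as a monotone right-continuous function. Its measure `dF`
satisfies `dF (]a, b]) = F(b) - F(a)`. -/
def spectralStieltjes {r s : ℕ} (f : L2Pow G r →L[ℂ] L2Pow G s) : StieltjesFunction ℝ where
  toFun := spectralDensity f
  mono' := spectralDensity_mono f
  right_continuous' := spectralDensity_rightCont f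

open Classical in
/-- The Fuglede-Kadison determinant of `f`: the number `exp (∫_{0+}^∞ ln t dF_f(t))` if the
integral converges, and `0` otherwise. -/
def fkDet {r s : ℕ} (f : L2Pow G r →L[ℂ] L2Pow G s) : ℝ :=
  if IntegrableOn Real.log (Set.Ioi 0) (spectralStieltjes f).measure then
    Real.exp (∫ t in Set.Ioi 0, Real.log t ∂(spectralStieltjes f).measure)
  else 0

end FugledeKadison

/-! ### The four Lehmer constants -/

section Constants

variable (G : Type*) [Group G]

/-- A weak isomorphism: an injective operator with dense image. -/
def IsWeakIso {G : Type*} {r s : ℕ} (f : L2Pow G r →L[ℂ] L2Pow G s) : Prop :=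
  Function.Injective f ∧ DenseRange f

/-- `Λ(G)`: all matrices over the integral group ring. -/
def lehmer : ℝ :=
  sInf {d : ℝ | 1 < d ∧ ∃ r s : ℕ, 1 ≤ r ∧ 1 ≤ s ∧
    ∃ A : Matrix (Fin r) (Fin s) (MonoidAlgebra ℤ G), fkDet (rightMulMatrix A) = d}

/-- `Λ₁(G)`: all `(1,1)`-matrices. -/
def lehmerOne : ℝ :=
  sInf {d : ℝ | 1 < d ∧
    ∃ A : Matrix (Fin 1) (Fin 1) (MonoidAlgebra ℤ G), fkDet (rightMulMatrix A) = d}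

/-- `Λ^w(G)`: all square matrices that induce a weak isomorphism. -/
def lehmerW : ℝ :=
  sInf {d : ℝ | 1 < d ∧ ∃ r : ℕ, 1 ≤ r ∧
    ∃ A : Matrix (Fin r) (Fin r) (MonoidAlgebra ℤ G),
      IsWeakIso (rightMulMatrix A) ∧ fkDet (rightMulMatrix A) = d}

/-- `Λ₁^w(G)`: all `(1,1)`-matrices that induce a weak isomorphism. -/
def lehmerWOne : ℝ :=
  sInf {d : ℝ | 1 < d ∧
    ∃ A : Matrix (Fin 1) (Fin 1) (MonoidAlgebra ℤ G),
      IsWeakIso (rightMulMatrix A) ∧ fkDet (rightMulMatrix A) = d}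

end Constants

end Lehmer

end

/-! Only finite subgroups matter. If `K ≤ G` is finite with norm element `N = ∑_{k ∈ K} k`, then
right multiplication by `N` is `|K|` times an orthogonal projection `P` of von Neumann trace
`1/|K|`. Hence `1 + N`, an integral `(1,1)`-matrix, gives the invertible operator `1 + |K| P`, with
singular value `1 + |K|` on `im P` and `1` on its complement. Its determinant is `(1 +
|K|)^(1/|K|)`, which exceeds `1` and tends to `1` as `|K|` grows. So arbitrarily large finite
subgroups force all four constants to be `1` (`lehmer_constants_eq_one`). This applies to the
lamplighter group, and to every group containing it.

For a finitely presented overgroup, take Baumslag's group. Conjugation by `s` propagates the single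
relation that `a` and `t a t⁻¹` commute to all conjugates of `a` by powers of `t`
(`commute_conj_pow`), so the lamplighter group maps to it. Injectivity is seen in an action by
affine maps on Laurent series over `𝔽₂`, where a lamp configuration becomes a Laurent polynomial. -/

namespace Lehmer

/-! ### Homomorphisms out of the lamplighter group -/

section LamplighterHom

variable {G : Type*} [Group G]

/-- If `s` commutes with `t`, and conjugation by `s` sends `a` to the product of `a` and its
conjugate by `t`, where these two commute, then `a` commutes with its conjugates by all natural
powers of `t`. -/
theorem commute_conj_pow {a s t : G} (hst : Commute s t) (hat : Commute a (t * a * t⁻¹))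
    (hsa : s * a * s⁻¹ = a * (t * a * t⁻¹)) (n : ℕ) :
    Commute a (MulAut.conj (t ^ n) a) := by
  have hsc (k : ℕ) : MulAut.conj s (MulAut.conj (t ^ k) a) =
      MulAut.conj (t ^ k) a * MulAut.conj (t ^ (k + 1)) a := by
    rw [← MulAut.mul_apply, ← map_mul, (hst.pow_right k).eq, map_mul, MulAut.mul_apply,
      MulAut.conj_apply s, hsa, map_mul, ← MulAut.conj_apply t, ← MulAut.mul_apply, ← map_mul,
      ← pow_succ]
  have htc (k l : ℕ) : MulAut.conj (t ^ k) (MulAut.conj (t ^ l) a) =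
      MulAut.conj (t ^ (k + l)) a := by
    rw [← MulAut.mul_apply, ← map_mul, ← pow_add]
  induction n using Nat.twoStepInduction with
  | zero => simp
  | one => simpa using hat
  | more n h0 h1 =>
    -- Write `a_k` for the conjugate of `a` by `t ^ k`. Conjugating `[a, a_{n+1}] = 1` by `s` shows
    -- that `a a_1` commutes with `a_{n+1} a_{n+2}`. Both `a` and `a_1` commute with `a_{n+1}`,
    -- which cancels; then `a_1` commutes with `a_{n+2}` and cancels too.
    have e1 : Commute (MulAut.conj (t ^ 1) a) (MulAut.conj (t ^ (n + 1)) a) := by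
      have := h0.map (MulAut.conj (t ^ 1))
      rwa [htc, add_comm 1 n] at this
    have e2 : Commute (MulAut.conj (t ^ 1) a) (MulAut.conj (t ^ (n + 2)) a) := by
      have := h1.map (MulAut.conj (t ^ 1))
      rwa [htc, add_comm 1 (n + 1)] at this
    have e3 := h1.map (MulAut.conj s)
    rw [hsc (n + 1), MulAut.conj_apply s, hsa] at e3
    have e4 : a * (t * a * t⁻¹) = a * MulAut.conj (t ^ 1) a := by simp
    rw [e4] at e3
    have e5 := (Commute.inv_right (h1.mul_left e1)).mul_right e3
    rw [inv_mul_cancel_left] at e5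
    have e6 := e5.mul_left e2.inv_left
    rwa [mul_inv_cancel_right] at e6

/-- Under the hypotheses of `commute_conj_pow`, all conjugates of `a` by powers of `t` commute. -/
theorem commute_conj_zpow {a s t : G} (hst : Commute s t) (hat : Commute a (t * a * t⁻¹))
    (hsa : s * a * s⁻¹ = a * (t * a * t⁻¹)) (i j : ℤ) :
    Commute (MulAut.conj (t ^ i) a) (MulAut.conj (t ^ j) a) := by
  wlog hij : i ≤ j generalizing i j
  · exact (this j i (le_of_not_ge hij)).symm
  obtain ⟨n, rfl⟩ := Int.le.dest hij
  have := (commute_conj_pow hst hat hsa n).map (MulAut.conj (t ^ i))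
  rwa [← MulAut.mul_apply, ← map_mul, ← zpow_natCast, ← zpow_add] at this

open scoped IsMulCommutative in
/-- There is a homomorphism on the lamp configurations that sends the lamp at `i` to the conjugate of `a`
by `t ^ i`. -/
theorem exists_lampHom {a t : G} (ha : a ^ 2 = 1)
    (hc : ∀ i j : ℤ, Commute (MulAut.conj (t ^ i) a) (MulAut.conj (t ^ j) a)) :
    ∃ f : Multiplicative (ℤ →₀ ZMod 2) →* G,
      ∀ i, f (.ofAdd (Finsupp.single i 1)) = MulAut.conj (t ^ i) a := by
  let S : Set G := Set.range fun i : ℤ => MulAut.conj (t ^ i) a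
  -- The universal property of the direct sum needs an abelian target, so the map is built into the
  -- subgroup generated by the commuting conjugates.
  have hS : IsMulCommutative (Subgroup.closure S) := Subgroup.isMulCommutative_closure (by
    rintro _ ⟨i, rfl⟩ _ ⟨j, rfl⟩
    exact hc i j)
  let c (i : ℤ) : Subgroup.closure S :=
    ⟨MulAut.conj (t ^ i) a, Subgroup.subset_closure ⟨i, rfl⟩⟩
  have hc2 (i : ℤ) : c i ^ 2 = 1 := by
    apply Subtype.ext
    change (MulAut.conj (t ^ i) a) ^ 2 = 1
    rw [← map_pow, ha, map_one]
  have hl (i : ℤ) : zmultiplesHom _ (Additive.ofMul (c i)) (2 : ℕ) = 0 := by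
    have : 2 • Additive.ofMul (c i) = 0 := hc2 i
    rwa [zmultiplesHom_apply, natCast_zsmul]
  let l (i : ℤ) : ZMod 2 →+ Additive (Subgroup.closure S) := ZMod.lift 2 ⟨_, hl i⟩
  refine ⟨(Subgroup.closure S).subtype.comp
    (AddMonoidHom.toMultiplicativeLeft (Finsupp.liftAddHom l)), fun i => ?_⟩
  have : l i 1 = Additive.ofMul (c i) := by
    have := ZMod.lift_coe 2 ⟨_, hl i⟩ 1
    simpa [l] using this
  simp [this, c]

theorem lampShift_single (n i : ℤ) (c : ZMod 2) :
    lampShift (.ofAdd n) (.ofAdd (Finsupp.single i c)) = .ofAdd (Finsupp.single (i + n) c) := by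
  change Multiplicative.ofAdd (Finsupp.domCongr (Equiv.addRight n) (Finsupp.single i c)) = _
  simp

/-- Two homomorphisms on the lamp configurations agree if they agree on the single lamps. -/
theorem lampConfig_hom_ext {f g : Multiplicative (ℤ →₀ ZMod 2) →* G}
    (h : ∀ i, f (.ofAdd (Finsupp.single i 1)) = g (.ofAdd (Finsupp.single i 1))) : f = g := by
  refine MonoidHom.ext fun u => ?_
  change f (.ofAdd u.toAdd) = g (.ofAdd u.toAdd)
  induction u.toAdd using Finsupp.induction_linear with
  | zero => simp
  | add u v hu hv => rw [ofAdd_add, map_mul, map_mul, hu, hv]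
  | single i c =>
    obtain rfl | rfl : c = 0 ∨ c = 1 := by revert c; decide
    · simp
    · exact h i

/-- Elements `a` and `t` such that `a` is an involution whose conjugates by powers of `t` commute
define a homomorphism from the lamplighter group. -/
theorem exists_lamplighterHom {a t : G} (ha : a ^ 2 = 1)
    (hc : ∀ i j : ℤ, Commute (MulAut.conj (t ^ i) a) (MulAut.conj (t ^ j) a)) :
    ∃ f : Lamplighter →* G,
      (∀ i, f (.inl (.ofAdd (Finsupp.single i 1))) = MulAut.conj (t ^ i) a) ∧
      ∀ n, f (.inr (.ofAdd n)) = t ^ n := by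
  obtain ⟨f, hf⟩ := exists_lampHom ha hc
  refine ⟨SemidirectProduct.lift f (zpowersHom G t) fun n => lampConfig_hom_ext fun i => ?_,
    fun i => ?_, fun n => ?_⟩
  · have h := lampShift_single n.toAdd i 1
    simp only [ofAdd_toAdd] at h
    simp only [MonoidHom.comp_apply, MulEquiv.coe_toMonoidHom, h, hf, zpowersHom_apply]
    rw [← MulAut.mul_apply, ← map_mul, ← zpow_add, add_comm]
  · simp [hf]
  · simp

end LamplighterHom

/-! ### Baumslag's finitely presented group -/

section BaumslagGroup

/-- The relations `a² = 1`, `s t = t s`, `a (t a t⁻¹) = (t a t⁻¹) a`, `s a s⁻¹ = a (t a t⁻¹)` of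
Baumslag's metabelian group, for the generators `a`, `s`, `t` numbered `0`, `1`, `2`. -/
def baumslagRels : Set (FreeGroup (Fin 3)) :=
  let a := FreeGroup.of 0
  let s := FreeGroup.of 1
  let t := FreeGroup.of 2
  {a ^ 2, (s * t) * (t * s)⁻¹, (a * (t * a * t⁻¹)) * ((t * a * t⁻¹) * a)⁻¹,
    (s * a * s⁻¹) * (a * (t * a * t⁻¹))⁻¹}

/-- Baumslag's finitely presented metabelian group, which contains the lamplighter group. -/
abbrev BaumslagGroup : Type := PresentedGroup baumslagRels

theorem baumslagRels_finite : baumslagRels.Finite := by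
  simp [baumslagRels]

theorem baumslagGroup_isFinitelyPresented : Group.IsFinitelyPresented BaumslagGroup := by
  have := baumslagRels_finite.to_subtype
  infer_instance

/-- Elements of a group that satisfy the relations of Baumslag's group define a homomorphism. -/
theorem exists_baumslagHom {G : Type*} [Group G] {a s t : G} (ha : a ^ 2 = 1)
    (hst : Commute s t) (hat : Commute a (t * a * t⁻¹))
    (hsa : s * a * s⁻¹ = a * (t * a * t⁻¹)) :
    ∃ f : BaumslagGroup →* G, f (.of 0) = a ∧ f (.of 1) = s ∧ f (.of 2) = t := by
  refine ⟨PresentedGroup.toGroup (f := ![a, s, t]) ?_, ?_, ?_, ?_⟩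
  · rintro r (rfl | rfl | rfl | rfl)
    · simpa using ha
    · simpa using mul_inv_eq_one.mpr hst.eq
    · simpa using mul_inv_eq_one.mpr hat.eq
    · simpa using mul_inv_eq_one.mpr hsa
  all_goals simp

/-- The generators of Baumslag's group satisfy its relations. -/
theorem baumslagGroup_relations :
    let a : BaumslagGroup := .of 0
    let s : BaumslagGroup := .of 1
    let t : BaumslagGroup := .of 2
    a ^ 2 = 1 ∧ Commute s t ∧ Commute a (t * a * t⁻¹) ∧ s * a * s⁻¹ = a * (t * a * t⁻¹) := by
  have key {r : FreeGroup (Fin 3)} (hr : r ∈ baumslagRels) : PresentedGroup.mk baumslagRels r = 1 :=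
    PresentedGroup.one_of_mem hr
  refine ⟨?_, ?_, ?_, ?_⟩
  · exact key (by simp [baumslagRels])
  · exact mul_inv_eq_one.mp (key (r := (.of 1 * .of 2) * (.of 2 * .of 1)⁻¹) (by simp [baumslagRels]))
  · exact mul_inv_eq_one.mp (key (r := (.of 0 * (.of 2 * .of 0 * (.of 2)⁻¹)) *
      ((.of 2 * .of 0 * (.of 2)⁻¹) * .of 0)⁻¹) (by simp [baumslagRels]))
  · exact mul_inv_eq_one.mp (key (r := (.of 1 * .of 0 * (.of 1)⁻¹) *
      (.of 0 * (.of 2 * .of 0 * (.of 2)⁻¹))⁻¹) (by simp [baumslagRels]))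

/-- The permutations `y ↦ 1 + y`, `y ↦ (1 + X) y` and `y ↦ X y` of the Laurent series over `𝔽₂`
satisfy the relations of Baumslag's group. -/
theorem exists_baumslagHom_laurentSeries :
    ∃ f : BaumslagGroup →* Equiv.Perm (LaurentSeries (ZMod 2)),
      (∀ y, f (.of 0) y = 1 + y) ∧
      ∀ (n : ℤ) y, (f (.of 2) ^ n) y = HahnSeries.single n 1 * y := by
  -- Laurent series form a field, so multiplication by `X` and by `1 + X` are both permutations.
  let x : LaurentSeries (ZMod 2) := HahnSeries.single 1 1
  have hx : x ≠ 0 := by simp [x]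
  have hx1 : 1 + x ≠ 0 := by
    intro h
    have := congrArg (fun z : LaurentSeries (ZMod 2) => z.coeff 0) h
    simp [x] at this
  have h2 : (1 : LaurentSeries (ZMod 2)) + 1 = 0 := by
    have : (1 : ZMod 2) + 1 = 0 := by decide
    rw [← HahnSeries.single_zero_one, ← HahnSeries.single_add, this, HahnSeries.single_eq_zero]
  let a : Equiv.Perm (LaurentSeries (ZMod 2)) := Equiv.addLeft 1
  let s : Equiv.Perm (LaurentSeries (ZMod 2)) := Equiv.mulLeft₀ (1 + x) hx1
  let t : Equiv.Perm (LaurentSeries (ZMod 2)) := Equiv.mulLeft₀ x hx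
  have hta : t * a * t⁻¹ = Equiv.addLeft x := by
    rw [mul_inv_eq_iff_eq_mul]
    ext1 y
    simp [t, a, mul_add]
  obtain ⟨f, hfa, -, hft⟩ := exists_baumslagHom (a := a) (s := s) (t := t)
    (by ext1 y; simp [a, pow_two, ← add_assoc, h2])
    (by ext1 y; simp [s, t]; ring)
    (by rw [hta]; ext1 y; simp [a]; ring)
    (by
      rw [hta, mul_inv_eq_iff_eq_mul]
      ext1 y
      simp [s, a]
      ring)
  refine ⟨f, fun y => by simp [hfa, a], fun n y => ?_⟩
  rw [hft]
  induction n generalizing y with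
  | zero => simp
  | succ n ih =>
    rw [zpow_add_one, Equiv.Perm.mul_apply, ih]
    simp [t, x, ← mul_assoc]
  | pred n ih =>
    -- Writing `y = X z` lets the extra factor `t⁻¹` cancel.
    obtain ⟨z, rfl⟩ := t.surjective y
    rw [← Equiv.Perm.mul_apply, zpow_sub_one, inv_mul_cancel_right, ih]
    simp [t, x, ← mul_assoc]

/-- The lamplighter group embeds into Baumslag's group. -/
theorem exists_lamplighter_embedding :
    ∃ i : Lamplighter →* BaumslagGroup, Function.Injective i := by
  obtain ⟨ha, hst, hat, hsa⟩ := baumslagGroup_relations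
  obtain ⟨i, hi1, hi2⟩ := exists_lamplighterHom ha (commute_conj_zpow hst hat hsa)
  obtain ⟨f, hf1, hf2⟩ := exists_baumslagHom_laurentSeries
  refine ⟨i, (injective_iff_map_eq_one i).mpr fun w hw => ?_⟩
  -- A configuration `u` acts as translation by `∑ u_k X^k`, so `w` acts as an affine map with
  -- linear part `X^n`. Its values at `0` and `1` recover both parts.
  have hinl (u : ℤ →₀ ZMod 2) (y : LaurentSeries (ZMod 2)) :
      f (i (.inl (.ofAdd u))) y = u.sum (fun k c => HahnSeries.single k c) + y := by
    induction u using Finsupp.induction_linear generalizing y with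
    | zero => simp
    | add u v hu hv =>
      rw [ofAdd_add, map_mul, map_mul, map_mul, Equiv.Perm.mul_apply, hu, hv,
        Finsupp.sum_add_index' (by simp) (by simp), add_assoc]
    | single k c =>
      obtain rfl | rfl : c = 0 ∨ c = 1 := by revert c; decide
      · simp
      · rw [hi1, MulAut.conj_apply, map_mul, map_mul, map_inv, map_zpow, ← zpow_neg,
          Equiv.Perm.mul_apply, Equiv.Perm.mul_apply, hf2, hf1, hf2]
        simp [mul_add, ← mul_assoc]
  have hw' (y : LaurentSeries (ZMod 2)) :
      w.left.toAdd.sum (fun k c => HahnSeries.single k c) +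
        HahnSeries.single w.right.toAdd 1 * y = y := by
    have h := congrArg (fun v => f v y) hw
    rw [← SemidirectProduct.inl_left_mul_inr_right w, map_mul] at h
    simp only [map_mul, Equiv.Perm.mul_apply, map_one, Equiv.Perm.one_apply] at h
    have h2 := hi2 w.right.toAdd
    rw [ofAdd_toAdd] at h2
    rw [h2, map_zpow, hf2] at h
    rw [← hinl]
    exact h
  have h0 := hw' 0
  rw [mul_zero, add_zero] at h0
  have h1 := hw' 1
  rw [h0, zero_add, mul_one, ← HahnSeries.single_zero_one] at h1
  have hr : w.right.toAdd = 0 := by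
    have := congrArg (fun z : LaurentSeries (ZMod 2) => z.coeff 0) h1
    by_contra hne
    simp [HahnSeries.coeff_single_of_ne (Ne.symm hne)] at this
  ext1
  · refine Multiplicative.toAdd.injective (Finsupp.ext fun k => ?_)
    have := congrArg (fun z : LaurentSeries (ZMod 2) => z.coeff k) h0
    rw [Finsupp.sum, HahnSeries.coeff_sum, Finset.sum_eq_single k
      (fun b _ hb => HahnSeries.coeff_single_of_ne hb.symm)
      (fun h => by rw [Finsupp.notMem_support_iff.mp h]; simp)] at this
    simpa using this
  · exact Multiplicative.toAdd.injective hr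

end BaumslagGroup

/-! ### Generators and finite subgroups of the lamplighter group -/

section LamplighterProperties

theorem lamplighter_fg : Group.FG Lamplighter := by
  let a : Lamplighter := .inl (.ofAdd (Finsupp.single 0 1))
  let t : Lamplighter := .inr (.ofAdd 1)
  refine Group.fg_iff.mpr ⟨{a, t}, (Subgroup.eq_top_iff' _).mpr fun w => ?_, by simp⟩
  have ha : a ∈ Subgroup.closure {a, t} := Subgroup.subset_closure (by simp)
  have ht : t ∈ Subgroup.closure {a, t} := Subgroup.subset_closure (by simp)
  have hr (n : ℤ) : SemidirectProduct.inr (.ofAdd n) ∈ Subgroup.closure {a, t} := by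
    have : t ^ n = .inr (.ofAdd n) := by rw [← map_zpow, ← ofAdd_zsmul, smul_eq_mul, mul_one]
    exact this ▸ zpow_mem ht n
  have hl (u : ℤ →₀ ZMod 2) : SemidirectProduct.inl (.ofAdd u) ∈ Subgroup.closure {a, t} := by
    induction u using Finsupp.induction_linear with
    | zero => exact one_mem _
    | add u v hu hv =>
      rw [ofAdd_add, map_mul]
      exact mul_mem hu hv
    | single k c =>
      obtain rfl | rfl : c = 0 ∨ c = 1 := by revert c; decide
      · rw [Finsupp.single_zero]
        exact one_mem _
      -- The lamp at `k` is the conjugate of the lamp at `0` by `t ^ k`.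
      · have h := lampShift_single k 0 1
        rw [zero_add] at h
        rw [← h, SemidirectProduct.inl_aut]
        exact mul_mem (mul_mem (hr k) ha) (hr (-k))
  rw [← SemidirectProduct.inl_left_mul_inr_right w]
  exact mul_mem (hl _) (hr _)

theorem lamplighter_finite_subgroups (n : ℕ) :
    ∃ K : Subgroup Lamplighter, Finite K ∧ n ≤ Nat.card K := by
  -- The lamps at `0, …, n - 1` generate a subgroup of order `2 ^ n ≥ n`.
  let j : Multiplicative (Fin n →₀ ZMod 2) →* Lamplighter :=
    SemidirectProduct.inl.comp (AddMonoidHom.toMultiplicative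
      (Finsupp.mapDomain.addMonoidHom fun k : Fin n => (k : ℤ)))
  have hj : Function.Injective j := by
    refine SemidirectProduct.inl_injective.comp ?_
    exact Finsupp.mapDomain_injective (Nat.cast_injective.comp Fin.val_injective)
  have hfin : Finite (Multiplicative (Fin n →₀ ZMod 2)) :=
    inferInstanceAs (Finite (Fin n →₀ ZMod 2))
  refine ⟨j.range, inferInstanceAs (Finite (Set.range j)), ?_⟩
  have e : Nat.card j.range = 2 ^ n := by
    rw [← Nat.card_congr (MonoidHom.ofInjective hj).toEquiv]
    change Nat.card (Fin n →₀ ZMod 2) = _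
    rw [Nat.card_eq_fintype_card]
    simp
  rw [e]
  exact Nat.lt_two_pow_self.le

end LamplighterProperties

/-! ### Spectral calculus of `1 + m P` for a projection `P` -/

section Projections

variable {H : Type*} [NormedAddCommGroup H] [InnerProductSpace ℂ H] [CompleteSpace H]

/-- The spectrum of `P` lies in `{0, 1}`, where `x ↦ g (1 + m x)` agrees with an affine function. -/
theorem cfc_one_add_smul {P : H →L[ℂ] H} (hP : IsStarProjection P) (m : ℝ) {g : ℝ → ℝ}
    (hg : Continuous g) :
    cfc g (1 + (m : ℂ) • P) = (g 1 : ℂ) • (1 - P) + (g (1 + m) : ℂ) • P := by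
  have hsa : IsSelfAdjoint P := hP.isSelfAdjoint
  have affine (α β : ℝ) : cfc (fun x : ℝ => α + β * x) P = (α : ℂ) • 1 + (β : ℂ) • P := by
    rw [cfc_const_add α (fun x => β * x) P (by fun_prop) hsa, cfc_const_mul_id β P hsa,
      Algebra.algebraMap_eq_smul_one, Complex.coe_smul, Complex.coe_smul]
  have hT : 1 + (m : ℂ) • P = cfc (fun x : ℝ => 1 + m * x) P := by
    rw [affine, Complex.ofReal_one, one_smul]
  rw [hT, ← cfc_comp' g (fun x : ℝ => 1 + m * x) P (by fun_prop) (by fun_prop) hsa]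
  have hEq : Set.EqOn (fun x : ℝ => g (1 + m * x)) (fun x => g 1 + (g (1 + m) - g 1) * x)
      (spectrum ℝ P) := by
    intro x hx
    rcases hP.isIdempotentElem.spectrum_subset ℝ hx with rfl | rfl
    · simp
    · simp
  rw [cfc_congr hEq, affine]
  push_cast
  module

theorem starProjection_eq_of_mem_iff {Q : H →L[ℂ] H} (hQ : IsStarProjection Q)
    {K : Submodule ℂ H} [K.HasOrthogonalProjection] (hK : ∀ x, x ∈ K ↔ Q x = x) :
    K.starProjection = Q := by
  have hQQ (x : H) : Q (Q x) = Q x := congrArg (· x) hQ.isIdempotentElem.eq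
  ext1 x
  refine Submodule.eq_starProjection_of_mem_orthogonal ((hK _).mpr (hQQ x)) ?_
  rw [Submodule.mem_orthogonal]
  intro y hy
  have hsymm := (ContinuousLinearMap.isSelfAdjoint_iff_isSymmetric.mp hQ.isSelfAdjoint) y (x - Q x)
  simp only [ContinuousLinearMap.coe_coe, (hK y).mp hy, map_sub, hQQ, sub_self,
    inner_zero_right] at hsymm
  exact hsymm

/-- The spectral projections of `1 + m P`, where `P` is a projection and `m > 0`. -/
theorem spectralProjection_one_add_smul {P : H →L[ℂ] H} (hP : IsStarProjection P) {m : ℝ}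
    (hm : 0 < m) (c : ℝ) :
    spectralProjection (1 + (m : ℂ) • P) c =
      if c < 1 then 0 else if c < 1 + m then 1 - P else 1 := by
  have hPP (x : H) : P (P x) = P x := congrArg (· x) hP.isIdempotentElem.eq
  have hmem (x : H) : x ∈ spectralSubspace (1 + (m : ℂ) • P) c ↔
      ((max (1 - c) 0 : ℝ) : ℂ) • (x - P x) + ((max (1 + m - c) 0 : ℝ) : ℂ) • P x = 0 := by
    change cfc (fun y : ℝ => max (y - c) 0) (1 + (m : ℂ) • P) x = 0 ↔ _
    rw [cfc_one_add_smul hP m (by fun_prop)]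
    rfl
  unfold spectralProjection
  split_ifs with h1 h2
  · refine starProjection_eq_of_mem_iff (.zero _) fun x => ?_
    rw [hmem, max_eq_left (by linarith), max_eq_left (by linarith)]
    constructor
    · intro h
      -- Applying `P` isolates the component in `im P`; both coefficients are nonzero.
      have h' := congrArg P h
      simp only [map_add, map_smul, map_sub, hPP, sub_self, smul_zero, zero_add, map_zero] at h'
      rw [h', add_zero] at h
      have h3 := (smul_eq_zero.mp h').resolve_left (Complex.ofReal_ne_zero.mpr (by linarith))
      have h4 := (smul_eq_zero.mp h).resolve_left (Complex.ofReal_ne_zero.mpr (by linarith))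
      rw [h3, sub_zero] at h4
      simp [h4]
    · intro h
      have h : x = 0 := by simpa using h.symm
      simp [h]
  · refine starProjection_eq_of_mem_iff hP.one_sub fun x => ?_
    rw [hmem, max_eq_right (by linarith), max_eq_left (by linarith), Complex.ofReal_zero,
      zero_smul, zero_add, smul_eq_zero_iff_right (Complex.ofReal_ne_zero.mpr (by linarith))]
    simp
  · refine starProjection_eq_of_mem_iff (.one _) fun x => ?_
    rw [hmem, max_eq_right (by linarith), max_eq_right (by linarith)]
    simp

theorem adjoint_comp_one_add_smul {P : H →L[ℂ] H} (hP : IsStarProjection P) (ν : ℝ) :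
    (1 + (ν : ℂ) • P).adjoint ∘L (1 + (ν : ℂ) • P) = 1 + (((1 + ν) ^ 2 - 1 : ℝ) : ℂ) • P := by
  rw [← ContinuousLinearMap.star_eq_adjoint]
  change star (1 + (ν : ℂ) • P) * (1 + (ν : ℂ) • P) = _
  rw [star_add, star_one, star_smul, hP.isSelfAdjoint.star_eq, RCLike.star_def, Complex.conj_ofReal]
  have := hP.isIdempotentElem.eq
  simp only [add_mul, mul_add, one_mul, mul_one, smul_mul_assoc, mul_smul_comm, this]
  push_cast
  module

theorem bijective_one_add_smul {P : H →L[ℂ] H} (hP : IsStarProjection P) {ν : ℝ} (hν : 0 < ν) :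
    Function.Bijective (1 + (ν : ℂ) • P : H →L[ℂ] H) := by
  have hPP (x : H) : P (P x) = P x := congrArg (· x) hP.isIdempotentElem.eq
  have hν' : (1 + ν : ℂ) ≠ 0 := by exact_mod_cast (by linarith : 1 + ν ≠ 0)
  -- On `im P` the inverse must scale by `1 / (1 + ν) = 1 - ν / (1 + ν)`.
  refine Function.bijective_iff_has_inverse.mpr ⟨fun x => x - (ν / (1 + ν) : ℂ) • P x,
    fun x => ?_, fun x => ?_⟩ <;>
  · simp only [add_apply, one_apply_eq_self, smul_apply, map_add, map_sub,
      map_smul, hPP]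
    match_scalars <;> field_simp
    ring

end Projections

/-! ### The determinant of `1 + ν P` -/

section Determinant

variable {G : Type*} [Group G]

theorem inner_basisVector {r : ℕ} (i : Fin r) (x : L2Pow G r) :
    inner ℂ (basisVector G i) x = x i 1 := by
  classical
  rw [PiLp.inner_apply, Finset.sum_eq_single i]
  · simp [basisVector, unitVector, lp.inner_single_left]
  · intro j _ hj
    simp [basisVector, hj]
  · simp

theorem norm_basisVector {r : ℕ} (i : Fin r) : ‖basisVector G i‖ = 1 := by
  classical
  have h : inner ℂ (basisVector G i) (basisVector G i) = 1 := by
    rw [inner_basisVector]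
    simp [basisVector, unitVector]
  rw [norm_eq_sqrt_re_inner (𝕜 := ℂ), h]
  simp

/-- The jumps sit at the singular values `1` and `1 + ν`, with heights the dimensions of `ker P` and
`im P`. The density compares `t ^ 2` with the spectrum of `f^* f`, which turns back into conditions
on `t`. -/
theorem spectralDensity_one_add_smul {r : ℕ} {P : L2Pow G r →L[ℂ] L2Pow G r}
    (hP : IsStarProjection P) {ν : ℝ} (hν : 0 < ν) (t : ℝ) :
    spectralDensity (1 + (ν : ℂ) • P) t =
      if t < 1 then 0 else if t < 1 + ν then r - (vonNeumannTrace P).re else r := by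
  unfold spectralDensity
  rcases lt_or_ge t 0 with ht | ht
  · rw [if_neg ht.not_ge, if_pos (by linarith)]
  rw [if_pos ht, vonNeumannDim_spectralSubspace, adjoint_comp_one_add_smul hP,
    spectralProjection_one_add_smul hP (by nlinarith)]
  have e1 : t ^ 2 < 1 ↔ t < 1 := by
    rw [sq_lt_one_iff₀ ht]
  have e2 : t ^ 2 < 1 + ((1 + ν) ^ 2 - 1) ↔ t < 1 + ν := by
    rw [add_sub_cancel, sq_lt_sq₀ ht (by linarith)]
  simp only [e1, e2]
  split_ifs
  · simp
  · simp [norm_basisVector, vonNeumannTrace]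
  · simp [norm_basisVector]

/-- The measure of a Stieltjes function that is constant but for two jumps. -/
theorem stieltjes_measure_eq_add_dirac {F : StieltjesFunction ℝ} {a b p q : ℝ}
    (hab : a < b) (hp : 0 ≤ p) (hq : 0 ≤ q)
    (hF : ∀ t, F t = if t < a then 0 else if t < b then p else p + q) :
    F.measure = ENNReal.ofReal p • Measure.dirac a + ENNReal.ofReal q • Measure.dirac b := by
  refine Measure.ext_of_Ioc _ _ fun c d hcd => ?_
  rw [StieltjesFunction.measure_Ioc, hF, hF]
  simp only [Measure.add_apply, Measure.smul_apply, Measure.dirac_apply' _ measurableSet_Ioc,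
    Set.indicator_apply, Set.mem_Ioc, ← not_lt, smul_eq_mul, Pi.one_apply, mul_ite, mul_one,
    mul_zero]
  by_cases h1 : c < a <;> by_cases h2 : d < a <;> by_cases h3 : c < b <;> by_cases h4 : d < b <;>
    first
    | (exfalso; linarith)
    | simp [h1, h2, h3, h4, ENNReal.ofReal_add hp hq]

theorem spectralStieltjes_measure_one_add_smul {r : ℕ} {P : L2Pow G r →L[ℂ] L2Pow G r}
    (hP : IsStarProjection P) {ν : ℝ} (hν : 0 < ν) :
    (spectralStieltjes (1 + (ν : ℂ) • P)).measure =
      ENNReal.ofReal (r - (vonNeumannTrace P).re) • Measure.dirac 1 +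
        ENNReal.ofReal (vonNeumannTrace P).re • Measure.dirac (1 + ν) := by
  have hF := spectralDensity_one_add_smul hP hν
  refine stieltjes_measure_eq_add_dirac (by linarith) ?_ ?_ fun t => ?_
  -- Both masses are nonnegative because the density is monotone across its jumps.
  · have := spectralDensity_mono (1 + (ν : ℂ) • P) (show (0 : ℝ) ≤ 1 by norm_num)
    simpa [hF, hν] using this
  · have := spectralDensity_mono (1 + (ν : ℂ) • P) (show (1 : ℝ) ≤ 1 + ν by linarith)
    simpa [hF, hν, hν.not_gt, hν.not_ge] using this
  · rw [sub_add_cancel]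
    exact hF t

/-- The atom at `1` contributes `log 1 = 0`, so only the atom at `1 + ν`, of mass the trace of `P`,
counts. -/
theorem fkDet_one_add_smul {r : ℕ} {P : L2Pow G r →L[ℂ] L2Pow G r}
    (hP : IsStarProjection P) {ν : ℝ} (hν : 0 < ν) (hd : 0 ≤ (vonNeumannTrace P).re) :
    fkDet (1 + (ν : ℂ) • P) = Real.exp ((vonNeumannTrace P).re * Real.log (1 + ν)) := by
  have hint1 : Integrable Real.log (ENNReal.ofReal (r - (vonNeumannTrace P).re) •
      Measure.dirac (1 : ℝ)) := (integrable_dirac (by simp)).smul_measure (by simp)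
  have hint2 : Integrable Real.log (ENNReal.ofReal (vonNeumannTrace P).re •
      Measure.dirac (1 + ν)) := (integrable_dirac (by simp)).smul_measure (by simp)
  have hrestrict : (spectralStieltjes (1 + (ν : ℂ) • P)).measure.restrict (Set.Ioi 0) =
      (spectralStieltjes (1 + (ν : ℂ) • P)).measure := by
    classical
    rw [spectralStieltjes_measure_one_add_smul hP hν, Measure.restrict_add, Measure.restrict_smul,
      Measure.restrict_smul, restrict_dirac' measurableSet_Ioi,
      restrict_dirac' measurableSet_Ioi, if_pos (by simp),
      if_pos (show 1 + ν ∈ Set.Ioi 0 by rw [Set.mem_Ioi]; linarith)]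
  unfold fkDet
  rw [IntegrableOn, hrestrict, spectralStieltjes_measure_one_add_smul hP hν,
    if_pos (hint1.add_measure hint2), integral_add_measure hint1 hint2]
  simp [ENNReal.toReal_ofReal hd]

end Determinant

/-! ### The averaging projection of a finite subgroup -/

section Averaging

variable {G : Type*} [Group G]

theorem rightTranslation_apply (h : G) (x : L2 G) (g : G) :
    rightTranslation h x g = x (g * h⁻¹) := rfl

theorem rightTranslation_one (x : L2 G) : rightTranslation 1 x = x := by
  ext g
  simp [rightTranslation_apply]

theorem rightTranslation_mul (h k : G) (x : L2 G) :
    rightTranslation h (rightTranslation k x) = rightTranslation (k * h) x := by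
  ext g
  simp [rightTranslation_apply, mul_assoc]

theorem inner_rightTranslation (h : G) (x y : L2 G) :
    inner ℂ (rightTranslation h x) y = inner ℂ x (rightTranslation h⁻¹ y) := by
  rw [← (rightTranslation h).inner_map_map x, rightTranslation_mul, inv_mul_cancel,
    rightTranslation_one]

theorem rightMul_add (a b : MonoidAlgebra ℤ G) : rightMul (a + b) = rightMul a + rightMul b := by
  classical
  change (a + b).coeff.sum (fun h c => (c : ℂ) • (rightTranslation h).toContinuousLinearMap) =
    a.coeff.sum (fun h c => (c : ℂ) • (rightTranslation h).toContinuousLinearMap) +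
    b.coeff.sum (fun h c => (c : ℂ) • (rightTranslation h).toContinuousLinearMap)
  rw [MonoidAlgebra.coeff_add]
  exact Finsupp.sum_add_index' (by simp) (by simp [add_smul])

theorem rightMul_single (h : G) (c : ℤ) :
    rightMul (.single h c) = (c : ℂ) • (rightTranslation h).toContinuousLinearMap := by
  change (MonoidAlgebra.single h c).coeff.sum
    (fun h c => (c : ℂ) • (rightTranslation h).toContinuousLinearMap) = _
  rw [MonoidAlgebra.coeff_single]
  exact Finsupp.sum_single_index (by simp)

theorem rightMul_sum {ι : Type*} (s : Finset ι) (a : ι → MonoidAlgebra ℤ G) :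
    rightMul (∑ i ∈ s, a i) = ∑ i ∈ s, rightMul (a i) :=
  map_sum (AddMonoidHom.mk' rightMul rightMul_add) a s

theorem rightMulMatrix_apply {r s : ℕ} (A : Matrix (Fin r) (Fin s) (MonoidAlgebra ℤ G))
    (x : L2Pow G r) (j : Fin s) : rightMulMatrix A x j = ∑ k, rightMul (A k j) (x k) := by
  simp [rightMulMatrix]

/-- The orthogonal projection of `L²(G)` onto the vectors invariant under right translation by a
finite subgroup `K`, as an operator on `L²(G)^1`. -/
noncomputable def averaging (K : Subgroup G) [Fintype K] : L2Pow G 1 →L[ℂ] L2Pow G 1 :=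
  (Fintype.card K : ℂ)⁻¹ • rightMulMatrix (.of fun _ _ => ∑ k : K, .single (k : G) 1)

theorem averaging_apply (K : Subgroup G) [Fintype K] (x : L2Pow G 1) (j : Fin 1) :
    averaging K x j = (Fintype.card K : ℂ)⁻¹ • ∑ k : K, rightTranslation (k : G) (x j) := by
  have : j = 0 := Subsingleton.elim _ _
  subst this
  rw [averaging, smul_apply, PiLp.smul_apply, rightMulMatrix_apply]
  simp [rightMul_sum, rightMul_single]

/-- Multiplication by an element of `K` permutes `K`, giving idempotence. The adjoint of translation
by `k` is translation by `k⁻¹`, and inversion permutes `K`, giving self-adjointness. -/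
theorem isStarProjection_averaging (K : Subgroup G) [Fintype K] :
    IsStarProjection (averaging K) := by
  have hcard : (Fintype.card K : ℂ) ≠ 0 := by simp
  refine ⟨?_, ContinuousLinearMap.isSelfAdjoint_iff_isSymmetric.mpr fun x y => ?_⟩
  · ext1 x
    ext1 j
    change averaging K (averaging K x) j = averaging K x j
    rw [averaging_apply, averaging_apply]
    congr 1
    simp only [map_smul, map_sum, rightTranslation_mul, ← Finset.smul_sum]
    rw [inv_smul_eq_iff₀ hcard]
    have h (k : K) : ∑ l : K, rightTranslation ((l : G) * k) (x j) =
        ∑ l : K, rightTranslation (l : G) (x j) :=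
      Equiv.sum_comp (Equiv.mulRight k) fun l : K => rightTranslation (l : G) (x j)
    simp only [h, Finset.sum_const, Finset.card_univ]
    exact (Nat.cast_smul_eq_nsmul ℂ _ _).symm
  · simp only [ContinuousLinearMap.coe_coe, PiLp.inner_apply, averaging_apply]
    refine Finset.sum_congr rfl fun j _ => ?_
    simp only [inner_smul_left, inner_smul_right, sum_inner, inner_sum, inner_rightTranslation]
    congr 1
    · simp
    · exact Equiv.sum_comp (Equiv.inv K) fun k : K => inner ℂ (x j) (rightTranslation (k : G) (y j))

/-- Only the term `k = 1` has a nonzero coefficient at the unit element. -/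
theorem vonNeumannTrace_averaging (K : Subgroup G) [Fintype K] :
    vonNeumannTrace (averaging K) = (Fintype.card K : ℂ)⁻¹ := by
  classical
  rw [vonNeumannTrace, Fin.sum_univ_one, inner_basisVector, averaging_apply, lp.coeFn_smul,
    Pi.smul_apply, lp.coeFn_sum, Finset.sum_apply, Finset.sum_eq_single 1]
  · simp [rightTranslation_apply, basisVector, unitVector]
  · intro k _ hk
    have : (k : G) ≠ 1 := by simpa using hk
    simp [rightTranslation_apply, basisVector, unitVector, this]
  · simp

theorem rightMulMatrix_one_add_sum (K : Subgroup G) [Fintype K] :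
    rightMulMatrix (.of fun _ _ : Fin 1 => 1 + ∑ k : K, MonoidAlgebra.single (k : G) (1 : ℤ)) =
      1 + ((Fintype.card K : ℝ) : ℂ) • averaging K := by
  have hcard : (Fintype.card K : ℂ) ≠ 0 := by simp
  rw [averaging, Complex.ofReal_natCast, smul_inv_smul₀ hcard]
  ext1 x
  ext1 j
  have : j = 0 := Subsingleton.elim _ _
  subst this
  rw [add_apply, PiLp.add_apply, rightMulMatrix_apply, rightMulMatrix_apply]
  simp [rightMul_add, MonoidAlgebra.one_def, rightMul_single, rightTranslation_one]

end Averaging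

/-! ### The Lehmer constants -/

section Constants

variable {G : Type*} [Group G]

/-- For a finite subgroup `K`, the element `1 + ∑_{k ∈ K} k` of the integral group ring has
Fuglede-Kadison determinant `(1 + |K|) ^ (1 / |K|)`. -/
theorem exists_fkDet_eq_exp (K : Subgroup G) [Fintype K] :
    ∃ A : Matrix (Fin 1) (Fin 1) (MonoidAlgebra ℤ G), IsWeakIso (rightMulMatrix A) ∧
      fkDet (rightMulMatrix A) = Real.exp (Real.log (1 + Fintype.card K) / Fintype.card K) := by
  have hcard : (0 : ℝ) < Fintype.card K := by exact_mod_cast Fintype.card_pos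
  have htr : (vonNeumannTrace (averaging K)).re = (Fintype.card K : ℝ)⁻¹ := by
    rw [vonNeumannTrace_averaging, ← Complex.ofReal_natCast, ← Complex.ofReal_inv,
      Complex.ofReal_re]
  refine ⟨.of fun _ _ => 1 + ∑ k : K, MonoidAlgebra.single (k : G) (1 : ℤ), ?_, ?_⟩
  · rw [rightMulMatrix_one_add_sum]
    have h := bijective_one_add_smul (isStarProjection_averaging K) hcard
    exact ⟨h.injective, h.surjective.denseRange⟩
  · rw [rightMulMatrix_one_add_sum, fkDet_one_add_smul (isStarProjection_averaging K) hcard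
      (by rw [htr]; positivity), htr, div_eq_inv_mul]

theorem exists_fkDet_lt (hG : ∀ n : ℕ, ∃ K : Subgroup G, Finite K ∧ n ≤ Nat.card K) {b : ℝ}
    (hb : 1 < b) :
    ∃ A : Matrix (Fin 1) (Fin 1) (MonoidAlgebra ℤ G), IsWeakIso (rightMulMatrix A) ∧
      1 < fkDet (rightMulMatrix A) ∧ fkDet (rightMulMatrix A) < b := by
  have hlim : Filter.Tendsto (fun n : ℕ => Real.exp (Real.log (1 + n) / n)) Filter.atTop
      (nhds 1) := by
    -- The exponent is `log x / (x - 1)` at `x = 1 + n`.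
    have h := (Real.tendsto_pow_log_div_mul_add_atTop 1 (-1) 1 one_ne_zero).comp
      (Filter.tendsto_atTop_add_const_left _ 1 (tendsto_natCast_atTop_atTop (R := ℝ)))
    simpa [Function.comp_def] using (Real.continuous_exp.tendsto 0).comp h
  obtain ⟨N, hN⟩ := Filter.eventually_atTop.mp (hlim.eventually_lt_const hb)
  obtain ⟨K, hK, hNK⟩ := hG N
  have := Fintype.ofFinite K
  rw [Nat.card_eq_fintype_card] at hNK
  obtain ⟨A, hA, hdet⟩ := exists_fkDet_eq_exp K
  have hcard : (0 : ℝ) < Fintype.card K := by exact_mod_cast Fintype.card_pos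
  refine ⟨A, hA, ?_, hdet ▸ hN _ hNK⟩
  rw [hdet, Real.one_lt_exp_iff]
  exact div_pos (Real.log_pos (by linarith)) hcard

theorem sInf_eq_one_of_forall_exists_lt {S : Set ℝ} (h1 : ∀ d ∈ S, 1 < d)
    (h2 : ∀ b, 1 < b → ∃ d ∈ S, d < b) : sInf S = 1 := by
  refine csInf_eq_of_forall_ge_of_forall_gt_exists_lt ?_ (fun d hd => (h1 d hd).le) h2
  -- Nonemptiness matters, since the real `sInf` of the empty set is `0`; any bound above `1` would
  -- serve.
  obtain ⟨d, hd, -⟩ := h2 2 one_lt_two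
  exact ⟨d, hd⟩

/-- All four Lehmer constants of a group with arbitrarily large finite subgroups are one. -/
theorem lehmer_constants_eq_one (hG : ∀ n : ℕ, ∃ K : Subgroup G, Finite K ∧ n ≤ Nat.card K) :
    lehmer G = 1 ∧ lehmerW G = 1 ∧ lehmerOne G = 1 ∧ lehmerWOne G = 1 := by
  refine ⟨?_, ?_, ?_, ?_⟩ <;>
    refine sInf_eq_one_of_forall_exists_lt (fun d hd => hd.1) fun b hb => ?_ <;>
    obtain ⟨A, hA, h1, h2⟩ := exists_fkDet_lt hG hb
  · exact ⟨_, ⟨h1, 1, 1, le_rfl, le_rfl, A, rfl⟩, h2⟩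
  · exact ⟨_, ⟨h1, 1, le_rfl, A, hA, rfl⟩, h2⟩
  · exact ⟨_, ⟨h1, A, rfl⟩, h2⟩
  · exact ⟨_, ⟨h1, A, hA, rfl⟩, h2⟩

theorem exists_finite_subgroup_of_injective {G' : Type*} [Group G'] {i : G →* G'}
    (hi : Function.Injective i) (hG : ∀ n : ℕ, ∃ K : Subgroup G, Finite K ∧ n ≤ Nat.card K)
    (n : ℕ) : ∃ K : Subgroup G', Finite K ∧ n ≤ Nat.card K := by
  obtain ⟨K, hK, hn⟩ := hG n
  let e := K.equivMapOfInjective i hi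
  exact ⟨K.map i, Finite.of_equiv K e.toEquiv, hn.trans_eq (Nat.card_congr e.toEquiv)⟩

end Constants

end Lehmer

theorem mainTheorem10 :
    -- the lamplighter group is finitely generated
    Group.FG Lehmer.Lamplighter ∧
    -- it contains finite subgroups of arbitrarily large order
    (∀ n : ℕ, ∃ K : Subgroup Lehmer.Lamplighter, Finite K ∧ n ≤ Nat.card K) ∧
    -- all its four Lehmer constants are one
    (Lehmer.lehmer Lehmer.Lamplighter = 1 ∧ Lehmer.lehmerW Lehmer.Lamplighter = 1 ∧
      Lehmer.lehmerOne Lehmer.Lamplighter = 1 ∧ Lehmer.lehmerWOne Lehmer.Lamplighter = 1) ∧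
    -- it embeds into a finitely presented group all of whose Lehmer constants are one
    ∃ (G : Type) (_ : Group G), Group.IsFinitelyPresented G ∧
      (∃ i : Lehmer.Lamplighter →* G, Function.Injective i) ∧
      Lehmer.lehmer G = 1 ∧ Lehmer.lehmerW G = 1 ∧
      Lehmer.lehmerOne G = 1 ∧ Lehmer.lehmerWOne G = 1 := by
  refine ⟨Lehmer.lamplighter_fg, Lehmer.lamplighter_finite_subgroups,
    Lehmer.lehmer_constants_eq_one Lehmer.lamplighter_finite_subgroups,
    Lehmer.BaumslagGroup, inferInstance, Lehmer.baumslagGroup_isFinitelyPresented,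
    Lehmer.exists_lamplighter_embedding, ?_⟩
  obtain ⟨i, hi⟩ := Lehmer.exists_lamplighter_embedding
  exact Lehmer.lehmer_constants_eq_one
    (Lehmer.exists_finite_subgroup_of_injective hi Lehmer.lamplighter_finite_subgroups)
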